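/- Let $\mathbb F$ be a field of characteristic $p>0$, let $\mathfrak g$ be a restricted Lie algebra over $\mathbb F$ with $p$-operator $g\mapsto g^{[p]}$, and let $\mathfrak h$ be a strongly abelian restricted Lie algebra over $\mathbb F$, that is, $[\mathfrak h,\mathfrak h]=0$ and $h^{[p]}=0$ for all $h\in\mathfrak h$ (no dimension is assumed finite). Write $[g_1,\dots,g_r]=[[\cdots[g_1,g_2],\cdots],g_r]$. The operator axioms are $(\lambda g)^{[p]}=\lambda^pg^{[p]}$, $(g+g')^{[p]}=g^{[p]}+g'^{[p]}+\sum\frac1{\#(g)}[g_1,\dots,g_p]$ and $[g,g'^{[p]}]=[g,g',\dots,g']$ ($p$ letters $g'$), where the sum runs over all words with $g_j\in\{g,g'\}$, $g_1=g$, $g_2=g'$, and $\#(g)$ is the number of letters $g$. A restricted extension of $\mathfrak g$ by $\mathfrak h$ is a short exact sequence $0\to\mathfrak h\xrightarrow{\iota}\mathfrak e\xrightarrow{\pi}\mathfrak g\to0$ of restricted Lie algebras and their homomorphisms (Lie homomorphisms commuting with the $p$-operators). Two are equivalent if there is an isomorphism $\alpha:\mathfrak e_1\to\mathfrak e_2$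 of restricted Lie algebras with $\alpha\iota_1=\iota_2$ and $\pi_2\alpha=\pi_1$. A restricted $\mathfrak g$-module is a $\mathfrak g$-module $M$ over $\mathbb F$ with $g^{[p]}\cdot m=g^p\cdot m$. For a restricted $\mathfrak g$-module $M$, let $C^2(\mathfrak g;M)$ be the space of pairs $(\varphi,\omega)$ with $\varphi:\mathfrak g\times\mathfrak g\to M$ alternating bilinear and $\omega:\mathfrak g\to M$ a map with $\omega(\lambda g)=\lambda^p\omega(g)$ and $$\omega(g+g')=\omega(g)+\omega(g')+\sum\frac1{\#(g)}\sum_{k=0}^{p-2}(-1)^kg_p\cdots g_{p-k+1}\,\varphi([g_1,\dots,g_{p-k-1}],g_{p-k}),$$ the outer sum being over the same words. For linear $\psi:\mathfrak g\to M$ put $\delta^1\psi=(\delta\psi,\tilde\psi)$, $\delta\psi(g,g')=-g\psi(g')+g'\psi(g)+\psi([g,g'])$, $\tilde\psi(g)=\psi(g^{[p]})-g^{p-1}\psi(g)$. Put $\delta^2(\varphi,\omega)=(\delta\varphi,\beta)$, where $$\delta\varphi(f,g,g')=\varphi([f,g],g')-\varphi([f,g'],g)+\varphi([g,g'],f)-f\varphi(g,g')+g\varphi(f,g')-g'\varphi(f,g),$$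 $$\beta(g,g')=\varphi(g,g'^{[p]})-\sum_{i+j=p-1}(-1)^ig'^i\varphi([g,\underbrace{g',\dots,g'}_j],g')+g\,\omega(g').$$ Then $\operatorname{Im}\delta^1\subseteq\operatorname{Ker}\delta^2\subseteq C^2(\mathfrak g;M)$, and $H^2(\mathfrak g;M)=\operatorname{Ker}\delta^2/\operatorname{Im}\delta^1$. **Theorem.** (1) Every restricted extension of $\mathfrak g$ by $\mathfrak h$ induces a unique restricted $\mathfrak g$-module structure on $\mathfrak h$ such that $\iota(\pi(x)\cdot h)=[x,\iota(h)]$ for all $x\in\mathfrak e$, $h\in\mathfrak h$. (2) For every restricted $\mathfrak g$-module structure on $\mathfrak h$, there is a bijection from the set of equivalence classes of restricted extensions of $\mathfrak g$ by $\mathfrak h$ that induce this module structure onto $H^2(\mathfrak g;\mathfrak h)$, with the following property: for every such extension and every linear map $\sigma:\mathfrak g\to\mathfrak e$ with $\pi\sigma=1_{\mathfrak g}$, the class of the extension is sent to the cohomology class of the cocycle $(\varphi,\omega)$ given by $$\iota\varphi(g,g')=[\sigma(g),\sigma(g')]-\sigma([g,g']),\qquad \iota\omega(g)=\sigma(g)^{[p]}-\sigma(g^{[p]}).$$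 -/

import Mathlib

set_option maxSynthPendingDepth 3

open LieModule.Cohomology

namespace RestrictedLie

universe u v w

/-- The left-nested bracket `[u 0, u 1, …, u n] = [[⋯[[u 0, u 1], u 2], ⋯], u n]`. -/
def nestedBracket {L : Type*} [LieRing L] (u : ℕ → L) : ℕ → L
  | 0 => u 0
  | n + 1 => ⁅nestedBracket u n, u (n + 1)⁆

/-- A word of length `p` in two letters `x`, `y`, beginning with `x` followed by `y`, is encoded by
the set `S ⊆ {0, …, p - 1}` of the positions of the letter `x`. The number of `x`'s is `S.card`. -/
def words (p : ℕ) : Finset (Finset ℕ) :=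
  {S ∈ (Finset.range p).powerset | 0 ∈ S ∧ 1 ∉ S}

/-- The letter in position `i` of the word encoded by `S`. -/
def letter {L : Type*} (x y : L) (S : Finset ℕ) (i : ℕ) : L :=
  if i ∈ S then x else y

/-- A restricted Lie algebra over a field `F` of characteristic `p`: a Lie algebra with a
`p`-operator `x ↦ x^[p]`. -/
class RestrictedLieAlgebra (F : Type*) (p : ℕ) (L : Type*) [Field F] [LieRing L]
    [LieAlgebra F L] where
  /-- The `p`-operator. -/
  pMap : L → L
  pMap_smul : ∀ (c : F) (x : L), pMap (c • x) = c ^ p • pMap x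
  pMap_add : ∀ x y : L, pMap (x + y) = pMap x + pMap y +
    ∑ S ∈ words p, (S.card : F)⁻¹ • nestedBracket (letter x y S) (p - 1)
  lie_pMap : ∀ x y : L, ⁅x, pMap y⁆ = (fun z ↦ ⁅z, y⁆)^[p] x

/-- The `p`-operator `x ↦ x^[p]` of a restricted Lie algebra. -/
def pMap (F : Type*) (p : ℕ) {L : Type*} [Field F] [LieRing L] [LieAlgebra F L]
    [RestrictedLieAlgebra F p L] (x : L) : L :=
  RestrictedLieAlgebra.pMap F p x

/-- Strongly abelian: zero bracket and zero `p`-operator. -/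
structure IsStronglyAbelian (F : Type*) (p : ℕ) (L : Type*) [Field F] [LieRing L] [LieAlgebra F L]
    [RestrictedLieAlgebra F p L] : Prop where
  lie_eq_zero : ∀ x y : L, ⁅x, y⁆ = 0
  pMap_eq_zero : ∀ x : L, pMap F p x = 0

/-- A restricted `g`-module structure on the vector space `M`: a homomorphism of restricted Lie
algebras `g → gl(M)`, where `gl(M)` carries the commutator bracket and the `p`-operator
`T ↦ T ^ p`. -/
structure RestrictedRep (F : Type*) (p : ℕ) (g M : Type*) [Field F] [LieRing g] [LieAlgebra F g]
    [RestrictedLieAlgebra F p g] [AddCommGroup M] [Module F M] where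
  /-- The action `x · m`, as a linear map `g → End(M)`. -/
  act : g →ₗ[F] Module.End F M
  act_lie : ∀ x y : g, act ⁅x, y⁆ = act x * act y - act y * act x
  act_pMap : ∀ x : g, act (pMap F p x) = act x ^ p

namespace RestrictedRep

variable {F : Type*} {p : ℕ} {g M : Type*} [Field F] [LieRing g] [LieAlgebra F g]
  [RestrictedLieAlgebra F p g] [AddCommGroup M] [Module F M]

/-- For letters `u 0, …, u (p - 1)` the alternating sum
`∑_{k = 0}^{p - 2} (-1)^k u_{p-1} ⋯ u_{p-k} · φ([u_0, …, u_{p-k-2}], u_{p-k-1})`. -/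
def starTerm (ρ : RestrictedRep F p g M) (φ : g →ₗ[F] g →ₗ[F] M) (u : ℕ → g) : M :=
  ∑ k ∈ Finset.range (p - 1),
    (-1 : F) ^ k • ((List.range k).map fun i ↦ ρ.act (u (p - 1 - i))).prod
      (φ (nestedBracket u (p - k - 2)) (u (p - k - 1)))

/-- `ω` has the star-property with respect to `φ`. -/
structure HasStarProperty (ρ : RestrictedRep F p g M) (φ : g →ₗ[F] g →ₗ[F] M) (ω : g → M) :
    Prop where
  map_smul : ∀ (c : F) (x : g), ω (c • x) = c ^ p • ω x
  map_add : ∀ x y : g, ω (x + y) = ω x + ω y +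
    ∑ S ∈ words p, (S.card : F)⁻¹ • ρ.starTerm φ (letter x y S)

lemma starTerm_add (ρ : RestrictedRep F p g M) (φ φ' : g →ₗ[F] g →ₗ[F] M) (u : ℕ → g) :
    ρ.starTerm (φ + φ') u = ρ.starTerm φ u + ρ.starTerm φ' u := by
  simp only [starTerm, LinearMap.add_apply, map_add, smul_add, Finset.sum_add_distrib]

lemma starTerm_smul (ρ : RestrictedRep F p g M) (c : F) (φ : g →ₗ[F] g →ₗ[F] M) (u : ℕ → g) :
    ρ.starTerm (c • φ) u = c • ρ.starTerm φ u := by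
  simp only [starTerm, LinearMap.smul_apply, map_smul, Finset.smul_sum]
  exact Finset.sum_congr rfl fun k _ ↦ smul_comm _ _ _

/-- The space `C²(g; M)` of restricted 2-cochains: pairs `(φ, ω)` of an alternating bilinear map
`φ` and a map `ω` that has the star-property with respect to `φ`. -/
def C2 (ρ : RestrictedRep F p g M) : Submodule F ((g →ₗ[F] g →ₗ[F] M) × (g → M)) where
  carrier := {c | c.1 ∈ twoCochain F g M ∧ ρ.HasStarProperty c.1 c.2}
  add_mem' {a b} ha hb := ⟨(twoCochain F g M).add_mem ha.1 hb.1,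
    { map_smul := fun c x ↦ by
        simp only [Prod.snd_add, Pi.add_apply, ha.2.map_smul, hb.2.map_smul, smul_add]
      map_add := fun x y ↦ by
        simp only [Prod.snd_add, Prod.fst_add, Pi.add_apply, ha.2.map_add, hb.2.map_add,
          starTerm_add, smul_add, Finset.sum_add_distrib]
        abel }⟩
  zero_mem' := ⟨(twoCochain F g M).zero_mem,
    { map_smul := fun c x ↦ by simp
      map_add := fun x y ↦ by simp [starTerm] }⟩
  smul_mem' t a ha := ⟨(twoCochain F g M).smul_mem t ha.1,
    { map_smul := fun c x ↦ by
        simp only [Prod.smul_snd, Pi.smul_apply, ha.2.map_smul]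
        exact smul_comm _ _ _
      map_add := fun x y ↦ by
        simp only [Prod.smul_snd, Prod.smul_fst, Pi.smul_apply, ha.2.map_add, starTerm_smul,
          smul_add, Finset.smul_sum]
        congr 1
        exact Finset.sum_congr rfl fun S _ ↦ smul_comm _ _ _ }⟩

/-- The classical coboundary of a 1-cochain,
`(δψ)(x, y) = - x · ψ(y) + y · ψ(x) + ψ([x, y])`. -/
def deltaCl1 (ρ : RestrictedRep F p g M) (ψ : g →ₗ[F] M) : g →ₗ[F] g →ₗ[F] M :=
  LinearMap.mk₂ F (fun x y ↦ -ρ.act x (ψ y) + ρ.act y (ψ x) + ψ ⁅x, y⁆)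
    (fun _ _ _ ↦ by simp; abel) (fun _ _ _ ↦ by simp)
    (fun _ _ _ ↦ by simp; abel) (fun _ _ _ ↦ by simp)

/-- The restricted coboundary `δ¹ψ = (δψ, ψ~)` of a 1-cochain `ψ`, with
`ψ~(x) = ψ(x^[p]) - x^{p-1} · ψ(x)`. -/
def delta1 (ρ : RestrictedRep F p g M) : (g →ₗ[F] M) →ₗ[F] (g →ₗ[F] g →ₗ[F] M) × (g → M) where
  toFun ψ := (ρ.deltaCl1 ψ, fun x ↦ ψ (pMap F p x) - (ρ.act x ^ (p - 1)) (ψ x))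
  map_add' ψ ψ' := by
    refine Prod.ext ?_ ?_
    · ext x y
      simp [deltaCl1]
      abel
    · funext x
      simp
      abel
  map_smul' c ψ := by
    refine Prod.ext ?_ ?_
    · ext x y
      simp [deltaCl1]
    · funext x
      simp [smul_sub]

/-- The classical coboundary of a 2-cochain. -/
def deltaCl2 (ρ : RestrictedRep F p g M) (φ : g →ₗ[F] g →ₗ[F] M) (x y z : g) : M :=
  φ ⁅x, y⁆ z - φ ⁅x, z⁆ y + φ ⁅y, z⁆ x - ρ.act x (φ y z) + ρ.act y (φ x z) - ρ.act z (φ x y)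

/-- The map induced by the pair `(φ, ω)`,
`β(x, y) = φ(x, y^[p]) - ∑_{i+j=p-1} (-1)^i y^i · φ([x, y, …, y], y) + x · ω(y)`,
with `j` letters `y` in the nested bracket. -/
def beta (ρ : RestrictedRep F p g M) (φ : g →ₗ[F] g →ₗ[F] M) (ω : g → M) (x y : g) : M :=
  φ x (pMap F p y)
    - ∑ i ∈ Finset.range p,
        (-1 : F) ^ i • (ρ.act y ^ i) (φ ((fun z ↦ ⁅z, y⁆)^[p - 1 - i] x) y)
    + ρ.act x (ω y)

/-- The restricted coboundary `δ²(φ, ω) = (δφ, β)`, with values in a space that contains the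
restricted 3-cochains. -/
def delta2 (ρ : RestrictedRep F p g M) :
    (g →ₗ[F] g →ₗ[F] M) × (g → M) →ₗ[F] (g → g → g → M) × (g → g → M) where
  toFun c := (ρ.deltaCl2 c.1, ρ.beta c.1 c.2)
  map_add' a b := by
    refine Prod.ext ?_ ?_
    · funext x y z
      simp only [deltaCl2, Prod.fst_add, LinearMap.add_apply, map_add, Pi.add_apply]
      abel
    · funext x y
      simp only [beta, Prod.fst_add, Prod.snd_add, LinearMap.add_apply, map_add, Pi.add_apply,
        smul_add, Finset.sum_add_distrib]
      abel
  map_smul' t a := by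
    refine Prod.ext ?_ ?_
    · funext x y z
      simp only [deltaCl2, Prod.smul_fst, LinearMap.smul_apply, map_smul, Pi.smul_apply, smul_add,
        smul_sub, RingHom.id_apply]
    · funext x y
      simp only [beta, Prod.smul_fst, Prod.smul_snd, LinearMap.smul_apply, map_smul, Pi.smul_apply,
        smul_add, smul_sub, RingHom.id_apply, Finset.smul_sum, smul_comm t]

/-- Restricted 2-cocycles: the kernel of `δ²` on `C²(g; M)`. -/
def Z2 (ρ : RestrictedRep F p g M) : Submodule F ((g →ₗ[F] g →ₗ[F] M) × (g → M)) :=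
  ρ.C2 ⊓ LinearMap.ker ρ.delta2

/-- Restricted 2-coboundaries: the image of `δ¹`. -/
def B2 (ρ : RestrictedRep F p g M) : Submodule F ((g →ₗ[F] g →ₗ[F] M) × (g → M)) :=
  LinearMap.range ρ.delta1

/-- The restricted cohomology space `H²(g; M)`. -/
abbrev H2 (ρ : RestrictedRep F p g M) : Type _ :=
  ρ.Z2 ⧸ ρ.B2.submoduleOf ρ.Z2

end RestrictedRep

/-- A restricted extension of `g` by `h`: a short exact sequence `0 → h → e → g → 0` of restricted
Lie algebras and homomorphisms of restricted Lie algebras; `e` is the field `L`. -/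
structure RestrictedExtension (F : Type u) (p : ℕ) (g : Type v) (h : Type w) [Field F]
    [LieRing g] [LieAlgebra F g] [RestrictedLieAlgebra F p g]
    [LieRing h] [LieAlgebra F h] [RestrictedLieAlgebra F p h] extends
    LieAlgebra.Extension.{u, w, v, max v w} F h g where
  instRestricted : RestrictedLieAlgebra F p L
  incl_pMap : ∀ m : h, incl (pMap F p m) = pMap F p (incl m)
  proj_pMap : ∀ x : L, proj (pMap F p x) = pMap F p (proj x)

namespace RestrictedExtension

variable {F : Type u} {p : ℕ} {g : Type v} {h : Type w} [Field F]
  [LieRing g] [LieAlgebra F g] [RestrictedLieAlgebra F p g]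
  [LieRing h] [LieAlgebra F h] [RestrictedLieAlgebra F p h]

instance (E : RestrictedExtension F p g h) : RestrictedLieAlgebra F p E.L := E.instRestricted

/-- The action of `g` on `h` given by the extension is `ρ`: `π(x) · m = [x, m]`. -/
def Induces (E : RestrictedExtension F p g h) (ρ : RestrictedRep F p g h) : Prop :=
  ∀ (x : E.L) (m : h), E.incl (ρ.act (E.proj x) m) = ⁅x, E.incl m⁆

/-- Equivalence of restricted extensions: an isomorphism of restricted Lie algebras that is the
identity on `h` and compatible with the projections to `g`. -/
def Equivalent (E₁ E₂ : RestrictedExtension F p g h) : Prop :=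
  ∃ α : E₁.L ≃ₗ⁅F⁆ E₂.L, (∀ x, α (pMap F p x) = pMap F p (α x)) ∧
    (∀ m, α (E₁.incl m) = E₂.incl m) ∧ ∀ x, E₂.proj (α x) = E₁.proj x

lemma Equivalent.refl (E : RestrictedExtension F p g h) : E.Equivalent E :=
  ⟨LieEquiv.refl, fun _ ↦ rfl, fun _ ↦ rfl, fun _ ↦ rfl⟩

lemma Equivalent.symm {E₁ E₂ : RestrictedExtension F p g h} :
    E₁.Equivalent E₂ → E₂.Equivalent E₁ := by
  rintro ⟨α, h₁, h₂, h₃⟩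
  refine ⟨α.symm, fun x ↦ α.injective (?_ : α _ = α _),
    fun m ↦ α.injective (?_ : α _ = α _), fun x ↦ ?_⟩
  · exact (α.apply_symm_apply _).trans (by rw [h₁, α.apply_symm_apply])
  · exact (α.apply_symm_apply _).trans (h₂ m).symm
  · rw [← h₃, α.apply_symm_apply]

lemma Equivalent.trans {E₁ E₂ E₃ : RestrictedExtension F p g h} :
    E₁.Equivalent E₂ → E₂.Equivalent E₃ → E₁.Equivalent E₃ := by
  rintro ⟨α, h₁, h₂, h₃⟩ ⟨β, k₁, k₂, k₃⟩
  refine ⟨α.trans β, fun x ↦ ?_, fun m ↦ ?_, fun x ↦ ?_⟩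
  · simp only [LieEquiv.trans_apply, h₁, k₁]
  · simp only [LieEquiv.trans_apply, h₂, k₂]
  · simp only [LieEquiv.trans_apply, h₃, k₃]

/-- Equivalence of the restricted extensions that induce the action `ρ`. -/
instance setoid (ρ : RestrictedRep F p g h) :
    Setoid {E : RestrictedExtension F p g h // E.Induces ρ} where
  r E₁ E₂ := E₁.1.Equivalent E₂.1
  iseqv := ⟨fun E ↦ Equivalent.refl E.1, Equivalent.symm, Equivalent.trans⟩

/-- Equivalence classes of restricted extensions of `g` by `h` that induce the action `ρ`. -/
abbrev Classes (ρ : RestrictedRep F p g h) : Type _ :=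
  Quotient (setoid ρ)

end RestrictedExtension

end RestrictedLie

/-! A linear section σ identifies 𝔢 with 𝔤 × 𝔥 as a vector space. Since 𝔥 is strongly abelian, the
rest of the structure is the module action together with the failure (φ, ω) of σ to respect bracket
and p-operator. The axioms of 𝔢 become equations for (φ, ω): Jacobi is δφ = 0, semilinearity and the
addition formula of the p-operator are the star-property, and [x, y^[p]] = [x, y, …, y] is β = 0.
The translation works because the correction sums in the last two are 𝔥-components of nested
brackets (`nestedTwist`).

From extensions to cocycles, `IsCocycleOf.nestedBracket_section` computes nested brackets of
elements σ(u i). Conversely, the operator (x, m)^[p] = (x^[p], x^{p-1}m + ω(x)) has to be verified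
on 𝔤 × 𝔥. For φ = 0 and ω = 0 the pair (x, m) acts on M × F as an affine transformation whose p-th
power is given by this operator, so Jacobson's formula and [x, y^p] = [x, y, …, y] in an associative
algebra supply the identities. A general φ changes nested brackets only by `nestedTwist`.

Two sections differ by some ψ : 𝔤 → 𝔥, and (x + ιm)^[p] = x^[p] + ι(x^{p-1}m) by
`Induces.pMap_add_incl`; hence the cocycle changes exactly by a coboundary. This yields
`equivalent_iff_sub_mem_B2`, from which the bijection follows. -/

namespace RestrictedLie

/-! ### Associative algebras in characteristic p and Jacobson's formula -/

section Associative

open Polynomial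

/-- In characteristic `p`, `(p - 1).choose k` is `(-1) ^ k`. -/
lemma cast_choose_pred_eq_neg_one_pow {R : Type*} [Ring R] (p : ℕ) [hp : Fact p.Prime] [CharP R p]
    {k : ℕ} (hk : k < p) : ((p - 1).choose k : R) = (-1) ^ k := by
  induction k with
  | zero => simp
  | succ k ih =>
    have h₁ : ((p.choose (k + 1) : ℕ) : R) = 0 :=
      (CharP.cast_eq_zero_iff R p _).2 (hp.out.dvd_choose_self (by omega) hk)
    have h₂ : p.choose (k + 1) = (p - 1).choose k + (p - 1).choose (k + 1) := by
      conv_lhs => rw [← Nat.sub_add_cancel hp.out.one_le]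
      exact Nat.choose_succ_succ _ _
    rw [h₂, Nat.cast_add, ih (by omega)] at h₁
    rw [pow_succ, mul_neg_one]
    exact eq_neg_of_add_eq_zero_right h₁

/-- The `(p - 1)`-st power of a difference of commuting elements in characteristic `p`. -/
lemma sub_pow_char_pred_of_commute {R : Type*} [Ring R] (p : ℕ) [hp : Fact p.Prime] [CharP R p]
    {a b : R} (hab : Commute a b) :
    (a - b) ^ (p - 1) = ∑ k ∈ Finset.range p, b ^ k * a ^ (p - 1 - k) := by
  have hp1 := Nat.sub_add_cancel hp.out.one_le
  rw [sub_eq_neg_add, (hab.symm.neg_left).add_pow, hp1]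
  refine Finset.sum_congr rfl fun k hk ↦ ?_
  rw [cast_choose_pred_eq_neg_one_pow p (Finset.mem_range.1 hk), ← neg_one_mul b,
    (Commute.neg_one_left b).mul_pow]
  have h₁ : Commute ((-1 : R) ^ k) (b ^ k * a ^ (p - 1 - k)) := (Commute.neg_one_left _).pow_left k
  rw [mul_assoc, mul_assoc, ← mul_assoc (b ^ k), ← h₁.eq, ← mul_assoc, ← pow_add,
    Even.neg_one_pow ⟨k, rfl⟩, one_mul]

/-- Leibniz rule without commutativity: P and its derivative need not commute, so the terms cannot
be collected. -/
lemma derivative_pow_eq_sum {A : Type*} [Semiring A] (P : A[X]) (n : ℕ) :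
    derivative (P ^ n) =
      ∑ k ∈ Finset.range n, P ^ k * derivative P * P ^ (n - 1 - k) := by
  induction n with
  | zero => simp
  | succ n ih =>
    rw [pow_succ, derivative_mul, ih, Finset.sum_range_succ, Finset.sum_mul]
    congr 1
    · refine Finset.sum_congr rfl fun k hk ↦ ?_
      have := Finset.mem_range.1 hk
      rw [mul_assoc, ← pow_succ]
      congr 2
      omega
    · simp

attribute [local instance] LieRing.ofAssociativeRing

/-- The operator `z ↦ [z, y]` of an associative ring is the difference of two commuting
multiplication operators. -/
lemma iterate_lie_right_eq {A : Type*} [Ring A] (x y : A) (n : ℕ) :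
    (fun z ↦ ⁅z, y⁆)^[n] x = ((LinearMap.mulRight ℤ y - LinearMap.mulLeft ℤ y) ^ n) x := by
  induction n with
  | zero => rfl
  | succ n ih =>
    rw [Function.iterate_succ_apply', ih, pow_succ', Module.End.mul_apply]
    rfl

/-- Left and right multiplication by y commute in this endomorphism ring, so binomial identities in
characteristic p apply to their difference. -/
lemma charP_moduleEnd_int (A : Type*) [Ring A] (p : ℕ) [CharP A p] :
    CharP (Module.End ℤ A) p where
  cast_eq_zero_iff n := by
    rw [← CharP.cast_eq_zero_iff A p n]
    constructor
    · intro h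
      simpa using LinearMap.congr_fun h 1
    · intro h
      ext z
      rw [Module.End.natCast_apply, ← Nat.cast_smul_eq_nsmul A, h, zero_smul,
        LinearMap.zero_apply]

/-- The compatibility of bracket and `p`-th power in an associative ring of characteristic `p`. -/
lemma lie_pow_char {A : Type*} [Ring A] (p : ℕ) [Fact p.Prime] [CharP A p] (x y : A) :
    ⁅x, y ^ p⁆ = (fun z ↦ ⁅z, y⁆)^[p] x := by
  have := charP_moduleEnd_int A p
  rw [iterate_lie_right_eq, sub_pow_char_of_commute p (LinearMap.commute_mulLeft_right y y).symm,
    LinearMap.pow_mulLeft, LinearMap.pow_mulRight]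
  rfl

/-- All signs cancel because (p - 1 choose k) = (-1)^k. The right side is the Leibniz expansion of
the derivative of a p-th power, which is how brackets enter Jacobson's formula. -/
lemma iterate_lie_pred_eq_sum {A : Type*} [Ring A] (p : ℕ) [Fact p.Prime] [CharP A p] (x y : A) :
    (fun z ↦ ⁅z, y⁆)^[p - 1] x = ∑ k ∈ Finset.range p, y ^ k * x * y ^ (p - 1 - k) := by
  have := charP_moduleEnd_int A p
  rw [iterate_lie_right_eq,
    sub_pow_char_pred_of_commute p (LinearMap.commute_mulLeft_right y y).symm,
    LinearMap.sum_apply]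
  refine Finset.sum_congr rfl fun k _ ↦ ?_
  rw [LinearMap.pow_mulLeft, LinearMap.pow_mulRight, Module.End.mul_apply, mul_assoc]
  rfl

/-- X is central: appending the letter x raises the exponent by one, appending y does not, so the
exponent counts letters x. -/
lemma lie_C_mul_X_pow {A : Type*} [Ring A] (x y z : A) (k : ℕ) :
    ⁅C z * X ^ k, C x * X + C y⁆ = C ⁅z, x⁆ * X ^ (k + 1) + C ⁅z, y⁆ * X ^ k := by
  simp only [Ring.lie_def, mul_add, add_mul, C_sub, C_mul, sub_mul, pow_succ]
  have h₁ : ∀ (a : A) (q : A[X]), X ^ k * (C a * q) = C a * (X ^ k * q) := fun a q ↦ by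
    rw [← mul_assoc, X_pow_mul, mul_assoc]
  have h₂ : ∀ (a : A), X ^ k * C a = C a * X ^ k := fun a ↦ X_pow_mul
  have h₃ : ∀ (a : A) (q : A[X]), X * (C a * q) = C a * (X * q) := fun a q ↦ by
    rw [← mul_assoc, X_mul, mul_assoc]
  simp only [mul_assoc, h₁, h₂, h₃, ← X_mul (p := X ^ k)]
  abel

lemma nestedBracket_congr {L : Type*} [LieRing L] {u v : ℕ → L} {n : ℕ}
    (h : ∀ i ≤ n, u i = v i) : nestedBracket u n = nestedBracket v n := by
  induction n with
  | zero => exact h 0 le_rfl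
  | succ n ih =>
    rw [nestedBracket, nestedBracket, ih fun i hi ↦ h i (by omega), h _ le_rfl]

lemma nestedBracket_eq_zero {L : Type*} [LieRing L] {u : ℕ → L} (h : u 0 = u 1) {n : ℕ}
    (hn : 1 ≤ n) : nestedBracket u n = 0 := by
  induction n, hn using Nat.le_induction with
  | base => simp [nestedBracket, h]
  | succ n _ ih => rw [nestedBracket, ih, zero_lie]

/-- The multilinear expansion of `[x, tx + y, …, tx + y]`. -/
lemma iterate_lie_eq_sum_powerset {A : Type*} [Ring A] (x y : A) (n : ℕ) :
    (fun z ↦ ⁅z, C x * X + C y⁆)^[n] (C x) =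
      ∑ T ∈ (Finset.Ioc 0 n).powerset,
        C (nestedBracket (letter x y (insert 0 T)) n) * X ^ T.card := by
  induction n with
  | zero => simp [nestedBracket, letter]
  | succ n ih =>
    have hn : n + 1 ∉ Finset.Ioc 0 n := by simp
    have hI : Finset.Ioc 0 (n + 1) = insert (n + 1) (Finset.Ioc 0 n) := by
      ext i; simp only [Finset.mem_insert, Finset.mem_Ioc]; omega
    rw [Function.iterate_succ_apply', ih, hI, Finset.sum_powerset_insert hn,
      ← Finset.sum_add_distrib, LieRing.of_associative_ring_bracket, Finset.sum_mul,
      Finset.mul_sum, ← Finset.sum_sub_distrib]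
    refine Finset.sum_congr rfl fun T hT ↦ ?_
    have hnT : n + 1 ∉ T := fun h ↦ hn (Finset.mem_powerset.1 hT h)
    rw [← Ring.lie_def, lie_C_mul_X_pow, Finset.card_insert_of_notMem hnT, add_comm]
    congr 3
    · rw [nestedBracket]
      simp [letter, hnT]
    · rw [nestedBracket, nestedBracket_congr (u := letter x y (insert 0 (insert (n + 1) T)))
        (v := letter x y (insert 0 T))]
      · simp [letter]
      · intro i hi
        have : i ≠ n + 1 := by omega
        simp [letter, this]

/-- The expansion fixes only the first letter. Words that begin with x, x contribute [x, x] = 0,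
which leaves those of `words p`. -/
lemma sum_powerset_eq_sum_words {M : Type*} [AddCommMonoid M] (p : ℕ) (hp : 1 < p)
    (f : Finset ℕ → M) (hf : ∀ T, 0 ∈ T → 1 ∈ T → f T = 0) :
    ∑ T ∈ (Finset.Ioc 0 (p - 1)).powerset, f (insert 0 T) = ∑ S ∈ words p, f S := by
  rw [← Finset.sum_filter_of_ne (p := fun T ↦ 1 ∉ T)]
  · refine Finset.sum_bij' (fun T _ ↦ insert 0 T) (fun S _ ↦ S.erase 0) ?_ ?_ ?_ ?_ ?_
    · intro T hT
      simp only [Finset.mem_filter, Finset.mem_powerset] at hT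
      simp only [words, Finset.mem_filter, Finset.mem_powerset, Finset.mem_insert, true_or,
        one_ne_zero, false_or, hT.2, not_false_eq_true, and_true]
      intro i hi
      rcases Finset.mem_insert.1 hi with rfl | hi
      · simp; omega
      · have := Finset.mem_Ioc.1 (hT.1 hi)
        simp; omega
    · intro S hS
      simp only [words, Finset.mem_filter, Finset.mem_powerset] at hS
      simp only [Finset.mem_filter, Finset.mem_powerset, Finset.mem_erase, hS.2.2, and_false,
        not_false_eq_true, and_true]
      intro i hi
      have h₁ := Finset.mem_erase.1 hi
      have := Finset.mem_range.1 (hS.1 h₁.2)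
      simp; omega
    · intro T hT
      simp only [Finset.mem_filter, Finset.mem_powerset] at hT
      exact Finset.erase_insert fun h ↦ by simpa using hT.1 h
    · intro S hS
      simp only [words, Finset.mem_filter] at hS
      exact Finset.insert_erase hS.2.1
    · intro T hT
      rfl
  · intro T _ hT h1
    exact hT (hf _ (Finset.mem_insert_self _ _) (Finset.mem_insert_of_mem h1))

lemma card_pos_of_mem_words {p : ℕ} {S : Finset ℕ} (hS : S ∈ words p) : 0 < S.card := by
  simp only [words, Finset.mem_filter] at hS
  exact Finset.card_pos.2 ⟨0, hS.2.1⟩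

lemma card_lt_of_mem_words {p : ℕ} (hp : 1 < p) {S : Finset ℕ} (hS : S ∈ words p) :
    S.card < p := by
  simp only [words, Finset.mem_filter, Finset.mem_powerset] at hS
  calc S.card < (Finset.range p).card :=
        Finset.card_lt_card ⟨hS.1, fun h ↦ hS.2.2 (h (Finset.mem_range.2 hp))⟩
    _ = p := Finset.card_range p

/-- The derivative of `(tx + y)^p` in terms of words in `x` and `y`. -/
lemma derivative_pow_char {A : Type*} [Ring A] (p : ℕ) [hp : Fact p.Prime] [CharP A p] (x y : A) :
    derivative ((C x * X + C y) ^ p) =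
      ∑ S ∈ words p, C (nestedBracket (letter x y S) (p - 1)) * X ^ (S.card - 1) := by
  have h : derivative (C x * X + C y) = C x := by simp
  rw [derivative_pow_eq_sum, h, ← iterate_lie_pred_eq_sum, iterate_lie_eq_sum_powerset,
    ← sum_powerset_eq_sum_words p hp.out.one_lt fun S ↦
      C (nestedBracket (letter x y S) (p - 1)) * X ^ (S.card - 1)]
  · refine Finset.sum_congr rfl fun T hT ↦ ?_
    have h0 : 0 ∉ T := fun h ↦ by simpa using Finset.mem_powerset.1 hT h
    rw [Finset.card_insert_of_notMem h0, Nat.add_sub_cancel]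
  · intro T h0 h1
    have hp2 := hp.out.two_le
    rw [nestedBracket_eq_zero (by simp [letter, h0, h1]) (by omega), C_0, zero_mul]

/-- **Jacobson's formula** for the `p`-th power of a sum in an associative algebra over a field of
characteristic `p`. -/
theorem add_pow_char_eq {F : Type*} [Field F] (p : ℕ) [hp : Fact p.Prime] [CharP F p]
    {A : Type*} [Ring A] [Algebra F A] [Nontrivial A] (x y : A) :
    (x + y) ^ p = x ^ p + y ^ p +
      ∑ S ∈ words p, (S.card : F)⁻¹ • nestedBracket (letter x y S) (p - 1) := by
  have : CharP A p := charP_of_injective_algebraMap (algebraMap F A).injective p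
  set P : A[X] := (C x * X + C y) ^ p with hP
  have hdeg : (C x * X + C y).natDegree ≤ 1 := natDegree_linear_le
  have hPdeg : P.natDegree < p + 1 :=
    Nat.lt_succ_of_le ((natDegree_pow_le_of_le p hdeg).trans_eq (mul_one p))
  have hp0 : P.coeff 0 = y ^ p := by
    rw [hP, ← constantCoeff_apply, map_pow]
    simp
  have hpp : P.coeff p = x ^ p := by
    have := coeff_pow_of_natDegree_le (m := p) hdeg
    rw [mul_one] at this
    rw [hP, this]
    simp
  -- Evaluation is multiplicative here only because the point 1 is central.
  have h1 : P.eval 1 = (x + y) ^ p := by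
    have := map_pow (eval₂RingHom' (RingHom.id A) (1 : A) fun a ↦ Commute.one_right a)
      (C x * X + C y) p
    change P.eval 1 = ((C x * X + C y).eval 1) ^ p at this
    simpa using this
  have hcoeff : ∀ n < p - 1, P.coeff (n + 1) =
      ∑ S ∈ words p with S.card = n + 1,
        (S.card : F)⁻¹ • nestedBracket (letter x y S) (p - 1) := by
    intro n hn
    have hn0 : ((n + 1 : ℕ) : F) ≠ 0 := fun h ↦ by
      have := Nat.le_of_dvd n.succ_pos ((CharP.cast_eq_zero_iff F p _).1 h)
      omega
    have h := congrArg (fun q ↦ q.coeff n) (derivative_pow_char p x y)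
    simp only [coeff_derivative, finsetSum_coeff, coeff_C_mul_X_pow] at h
    rw [← Nat.cast_succ, Nat.succ_eq_add_one, ← nsmul_eq_mul', ← Nat.cast_smul_eq_nsmul F,
      ← hP] at h
    -- Differentiation multiplies this coefficient by n + 1, which is invertible since n + 1 < p;
    -- dividing produces the factor 1/#(x).
    rw [← inv_smul_smul₀ hn0 (P.coeff (n + 1)), h, Finset.smul_sum, Finset.sum_filter]
    refine Finset.sum_congr rfl fun S hS ↦ ?_
    have := card_pos_of_mem_words hS
    by_cases hc : S.card = n + 1
    · rw [if_pos (by omega), if_pos hc, hc]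
    · rw [if_neg (by omega), if_neg hc, smul_zero]
  have hp1 := Nat.sub_add_cancel hp.out.one_le
  rw [← h1, eval_eq_sum_range' hPdeg]
  simp only [one_pow, mul_one]
  rw [Finset.sum_range_succ, hpp, ← hp1, Finset.sum_range_succ', hp1, hp0,
    Finset.sum_congr rfl fun n hn ↦ hcoeff n (Finset.mem_range.1 hn),
    ← Finset.sum_fiberwise_of_maps_to (s := words p) (t := Finset.range (p - 1))
      (g := fun S ↦ S.card - 1)]
  · have : ∀ n, {S ∈ words p | S.card - 1 = n} = {S ∈ words p | S.card = n + 1} := fun n ↦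
      Finset.filter_congr fun S hS ↦ by
        have := card_pos_of_mem_words hS
        omega
    simp only [this]
    abel
  · intro S hS
    have h₁ := card_pos_of_mem_words hS
    have h₂ := card_lt_of_mem_words hp.out.one_lt hS
    rw [Finset.mem_range]
    omega

end Associative

/-! ### Words and nested brackets -/

section Nested

lemma iterate_lie_eq_nestedBracket {L : Type*} [LieRing L] (x y : L) (n : ℕ) :
    (fun z ↦ ⁅z, y⁆)^[n] x = nestedBracket (letter x y {0}) n := by
  induction n with
  | zero => simp [nestedBracket, letter]
  | succ n ih =>
    rw [Function.iterate_succ_apply', ih, nestedBracket]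
    simp [letter]

lemma map_letter {L L' : Type*} (f : L → L') (x y : L) (S : Finset ℕ) :
    (fun i ↦ f (letter x y S i)) = letter (f x) (f y) S := by
  funext i
  simp only [letter]
  split_ifs <;> rfl

end Nested

lemma pMap_zero {F : Type*} {p : ℕ} [hp : Fact p.Prime] {L : Type*} [Field F] [LieRing L]
    [LieAlgebra F L] [RestrictedLieAlgebra F p L] : pMap F p (0 : L) = 0 := by
  have := RestrictedLieAlgebra.pMap_smul (p := p) (0 : F) (0 : L)
  rwa [zero_smul, zero_pow hp.out.ne_zero, zero_smul] at this

/-! ### The correction sums as components of nested brackets -/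

namespace RestrictedRep

variable {F : Type*} {p : ℕ} {g M : Type*} [Field F] [LieRing g] [LieAlgebra F g]
  [RestrictedLieAlgebra F p g] [AddCommGroup M] [Module F M]

@[ext]
lemma ext {ρ ρ' : RestrictedRep F p g M} (h : ∀ x m, ρ.act x m = ρ'.act x m) : ρ = ρ' := by
  cases ρ
  cases ρ'
  congr
  ext x m
  exact h x m

/-- The `M`-component of the nested bracket `[(u 0, 0), …, (u n, 0)]` in the extension of `g` by
`M` with bracket twisted by `φ`. -/
def nestedTwist (ρ : RestrictedRep F p g M) (φ : g →ₗ[F] g →ₗ[F] M) (u : ℕ → g) : ℕ → M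
  | 0 => 0
  | n + 1 => φ (nestedBracket u n) (u (n + 1)) - ρ.act (u (n + 1)) (nestedTwist ρ φ u n)

/-- Unrolling the recursion: k is the number of letters that act after φ has been applied, each with
a sign. -/
lemma nestedTwist_eq_sum (ρ : RestrictedRep F p g M) (φ : g →ₗ[F] g →ₗ[F] M) (u : ℕ → g) (n : ℕ) :
    ρ.nestedTwist φ u n = ∑ k ∈ Finset.range n,
      (-1 : F) ^ k • ((List.range k).map fun i ↦ ρ.act (u (n - i))).prod
        (φ (nestedBracket u (n - k - 1)) (u (n - k))) := by
  induction n with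
  | zero => simp [nestedTwist]
  | succ n ih =>
    rw [nestedTwist, ih, Finset.sum_range_succ', map_sum, sub_eq_neg_add, ← Finset.sum_neg_distrib]
    congr 1
    · refine Finset.sum_congr rfl fun k _ ↦ ?_
      rw [List.range_succ_eq_map, List.map_cons, List.prod_cons, List.map_map, map_smul, pow_succ,
        mul_neg_one, neg_smul, Module.End.mul_apply]
      simp only [Nat.add_sub_add_right, Nat.sub_zero, Function.comp_def, Nat.succ_eq_add_one]
    · simp

lemma starTerm_eq_nestedTwist (ρ : RestrictedRep F p g M) (φ : g →ₗ[F] g →ₗ[F] M) (u : ℕ → g) :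
    ρ.starTerm φ u = ρ.nestedTwist φ u (p - 1) := by
  rw [nestedTwist_eq_sum, starTerm]
  refine Finset.sum_congr rfl fun k _ ↦ ?_
  rw [show p - k - 2 = p - 1 - k - 1 by omega, show p - k - 1 = p - 1 - k by omega]

/-- The sum in β is the twist of the word x, y, …, y with p letters y; no position after the first
is an x, so the operators form a power of y. -/
lemma beta_eq (ρ : RestrictedRep F p g M) (φ : g →ₗ[F] g →ₗ[F] M) (ω : g → M) (x y : g) :
    ρ.beta φ ω x y =
      φ x (pMap F p y) - ρ.nestedTwist φ (letter x y {0}) p + ρ.act x (ω y) := by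
  rw [beta, nestedTwist_eq_sum]
  congr 2
  refine Finset.sum_congr rfl fun k hk ↦ ?_
  have hk := Finset.mem_range.1 hk
  have h : ((List.range k).map fun i ↦ ρ.act (letter x y {0} (p - i))) =
      (List.range k).map fun _ ↦ ρ.act y := by
    refine List.map_congr_left fun i hi ↦ ?_
    have := List.mem_range.1 hi
    rw [letter, if_neg (by simp; omega)]
  rw [h, List.map_const', List.prod_replicate, List.length_range, iterate_lie_eq_nestedBracket,
    Nat.sub_right_comm]
  congr 3
  rw [letter, if_neg (by simp; omega)]

/-! ### The affine representation of the split extension -/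

section Affine

attribute [local instance] LieRing.ofAssociativeRing

/-- The affine transformation `v ↦ x · v + m` of `M`, as a linear endomorphism of `M × F`. -/
def affine (ρ : RestrictedRep F p g M) (x : g) (m : M) : Module.End F (M × F) :=
  LinearMap.inl F M F ∘ₗ (ρ.act x).coprod (LinearMap.toSpanSingleton F M m)

@[simp]
lemma affine_apply (ρ : RestrictedRep F p g M) (x : g) (m : M) (v : M × F) :
    ρ.affine x m v = (ρ.act x v.1 + v.2 • m, 0) := by
  simp [affine]

lemma affine_add (ρ : RestrictedRep F p g M) (x y : g) (m n : M) :
    ρ.affine (x + y) (m + n) = ρ.affine x m + ρ.affine y n := by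
  refine LinearMap.ext fun v ↦ ?_
  simp only [affine_apply, LinearMap.add_apply, map_add, smul_add, Prod.mk_add_mk, add_zero]
  congr 1
  abel

lemma lie_affine (ρ : RestrictedRep F p g M) (x y : g) (m n : M) :
    ⁅ρ.affine x m, ρ.affine y n⁆ = ρ.affine ⁅x, y⁆ (ρ.act x n - ρ.act y m) := by
  refine LinearMap.ext fun v ↦ ?_
  simp only [Ring.lie_def, LinearMap.sub_apply, Module.End.mul_apply, affine_apply, ρ.act_lie,
    map_add, map_smul, zero_smul, add_zero, smul_sub, Prod.mk_sub_mk, sub_self]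
  congr 1
  abel

lemma affine_pow_succ (ρ : RestrictedRep F p g M) (x : g) (m : M) (n : ℕ) (v : M × F) :
    (ρ.affine x m ^ (n + 1)) v = ((ρ.act x ^ (n + 1)) v.1 + v.2 • (ρ.act x ^ n) m, 0) := by
  induction n with
  | zero => simp
  | succ n ih =>
    rw [pow_succ', Module.End.mul_apply, ih, affine_apply, map_add, zero_smul, add_zero, map_smul,
      pow_succ' (ρ.act x) (n + 1), pow_succ' (ρ.act x) n]
    rfl

/-- This dictates the term x^{p-1}m of the p-operator on an extension. -/
lemma affine_pow [hp : Fact p.Prime] (ρ : RestrictedRep F p g M) (x : g) (m : M) :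
    ρ.affine x m ^ p = ρ.affine (pMap F p x) ((ρ.act x ^ (p - 1)) m) := by
  refine LinearMap.ext fun v ↦ ?_
  have := ρ.affine_pow_succ x m (p - 1) v
  rw [Nat.sub_add_cancel hp.out.one_le] at this
  rw [this, affine_apply, ρ.act_pMap]

/-- Evaluation at (0, 1) turns operator identities into identities in M. -/
lemma affine_apply_zero_one (ρ : RestrictedRep F p g M) (x : g) (m : M) :
    (ρ.affine x m (0, 1)).1 = m := by
  simp

end Affine

/-- The product of `g` and `M`, carrying the restricted Lie algebra structure that is twisted by a
restricted 2-cocycle. -/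
@[ext]
structure Twisted (ρ : RestrictedRep F p g M) (c : ρ.Z2) where
  /-- The component in the Lie algebra. -/
  fst : g
  /-- The component in the module. -/
  snd : M

/-! ### The restricted Lie algebra defined by a cocycle -/

namespace Twisted

variable {ρ : RestrictedRep F p g M} (c : ρ.Z2)

/-- The underlying vector space is a product. -/
def equivProd : ρ.Twisted c ≃ g × M where
  toFun x := (x.1, x.2)
  invFun x := ⟨x.1, x.2⟩

instance : AddCommGroup (ρ.Twisted c) := (equivProd c).addCommGroup
instance : Module F (ρ.Twisted c) := (equivProd c).module F

variable {c}

@[simp] lemma fst_add (x y : ρ.Twisted c) : (x + y).1 = x.1 + y.1 := rfl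
@[simp] lemma snd_add (x y : ρ.Twisted c) : (x + y).2 = x.2 + y.2 := rfl
@[simp] lemma fst_zero : (0 : ρ.Twisted c).1 = 0 := rfl
@[simp] lemma snd_zero : (0 : ρ.Twisted c).2 = 0 := rfl
@[simp] lemma fst_smul (a : F) (x : ρ.Twisted c) : (a • x).1 = a • x.1 := rfl
@[simp] lemma snd_smul (a : F) (x : ρ.Twisted c) : (a • x).2 = a • x.2 := rfl

lemma cocycle_self (x : g) : c.1.1 x x = 0 := c.2.1.1 x

lemma cocycle_skew (x y : g) : c.1.1 x y = -c.1.1 y x := by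
  have := cocycle_self (c := c) (x + y)
  simp only [map_add, LinearMap.add_apply, cocycle_self, zero_add, add_zero] at this
  exact eq_neg_of_add_eq_zero_right this

lemma deltaCl2_eq_zero (x y z : g) : ρ.deltaCl2 c.1.1 x y z = 0 := by
  have := (LinearMap.mem_ker.1 c.2.2)
  exact congrFun (congrFun (congrFun (congrArg Prod.fst this) x) y) z

lemma beta_eq_zero (x y : g) : ρ.beta c.1.1 c.1.2 x y = 0 := by
  have := (LinearMap.mem_ker.1 c.2.2)
  exact congrFun (congrFun (congrArg Prod.snd this) x) y

instance : Bracket (ρ.Twisted c) (ρ.Twisted c) where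
  bracket x y := ⟨⁅x.1, y.1⁆, c.1.1 x.1 y.1 + ρ.act x.1 y.2 - ρ.act y.1 x.2⟩

@[simp] lemma fst_lie (x y : ρ.Twisted c) : ⁅x, y⁆.1 = ⁅x.1, y.1⁆ := rfl
@[simp] lemma snd_lie (x y : ρ.Twisted c) :
    ⁅x, y⁆.2 = c.1.1 x.1 y.1 + ρ.act x.1 y.2 - ρ.act y.1 x.2 := rfl

instance : LieRing (ρ.Twisted c) where
  add_lie x y z := by
    ext
    · simp
    · simp; abel
  lie_add x y z := by
    ext
    · simp
    · simp; abel
  lie_self x := by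
    ext
    · simp
    · simp [cocycle_self]
  leibniz_lie x y z := by
    ext
    · simp
    -- The module component of the Leibniz identity is δφ = 0, once skew-symmetry has moved the
    -- inner brackets to the second argument.
    · have h := deltaCl2_eq_zero (c := c) x.1 y.1 z.1
      rw [deltaCl2, cocycle_skew ⁅y.1, z.1⁆, cocycle_skew ⁅x.1, z.1⁆] at h
      simp only [snd_lie, fst_lie, snd_add, map_add, map_sub, ρ.act_lie, LinearMap.sub_apply,
        Module.End.mul_apply]
      linear_combination (norm := module) (-1 : F) • h

instance : LieAlgebra F (ρ.Twisted c) where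
  lie_smul a x y := by
    ext
    · simp
    · simp [smul_sub]

lemma fst_nestedBracket (u : ℕ → ρ.Twisted c) (n : ℕ) :
    (nestedBracket u n).1 = nestedBracket (fun i ↦ (u i).1) n := by
  induction n with
  | zero => rfl
  | succ n ih => rw [nestedBracket, nestedBracket, fst_lie, ih]

@[simp]
lemma fst_sum {ι : Type*} (s : Finset ι) (f : ι → ρ.Twisted c) :
    (∑ i ∈ s, f i).1 = ∑ i ∈ s, (f i).1 :=
  map_sum (AddMonoidHom.mk' (fun x : ρ.Twisted c ↦ x.1) fun _ _ ↦ rfl) f s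

@[simp]
lemma snd_sum {ι : Type*} (s : Finset ι) (f : ι → ρ.Twisted c) :
    (∑ i ∈ s, f i).2 = ∑ i ∈ s, (f i).2 :=
  map_sum (AddMonoidHom.mk' (fun x : ρ.Twisted c ↦ x.2) fun _ _ ↦ rfl) f s

section Affine

attribute [local instance] LieRing.ofAssociativeRing

/-- The affine operators see only the split bracket; `nestedTwist` is exactly the contribution of φ
to the twisted one. -/
lemma nestedBracket_affine (u : ℕ → ρ.Twisted c) (n : ℕ) :
    nestedBracket (fun i ↦ ρ.affine (u i).1 (u i).2) n =
      ρ.affine (nestedBracket (fun i ↦ (u i).1) n)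
        ((nestedBracket u n).2 - ρ.nestedTwist c.1.1 (fun i ↦ (u i).1) n) := by
  induction n with
  | zero => simp [nestedBracket, nestedTwist]
  | succ n ih =>
    rw [nestedBracket, ih, lie_affine, nestedBracket, nestedBracket, nestedTwist, snd_lie,
      fst_nestedBracket, map_sub]
    congr 1
    abel

lemma act_pow_add [hp : Fact p.Prime] [CharP F p] (x y : ρ.Twisted c) :
    (ρ.act (x.1 + y.1) ^ (p - 1)) (x.2 + y.2) =
      (ρ.act x.1 ^ (p - 1)) x.2 + (ρ.act y.1 ^ (p - 1)) y.2 +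
        ∑ S ∈ words p, (S.card : F)⁻¹ • ((nestedBracket (letter x y S) (p - 1)).2 -
          ρ.starTerm c.1.1 (letter x.1 y.1 S)) := by
  -- The factor F keeps the endomorphism algebra of M × F nontrivial even when M = 0.
  have h := add_pow_char_eq (F := F) p (ρ.affine x.1 x.2) (ρ.affine y.1 y.2)
  rw [← affine_add, affine_pow, affine_pow, affine_pow] at h
  have h' := congrArg Prod.fst (LinearMap.congr_fun h ((0 : M), (1 : F)))
  simp only [LinearMap.add_apply, LinearMap.sum_apply, LinearMap.smul_apply, Prod.fst_add,
    Prod.fst_sum, Prod.smul_fst, affine_apply_zero_one] at h'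
  rw [h']
  congr 1
  refine Finset.sum_congr rfl fun S _ ↦ ?_
  rw [← map_letter (fun z : ρ.Twisted c ↦ ρ.affine z.1 z.2) x y S, nestedBracket_affine,
    affine_apply_zero_one, map_letter (fun z : ρ.Twisted c ↦ z.1), starTerm_eq_nestedTwist]

lemma act_pow_lie [hp : Fact p.Prime] [CharP F p] (x y : ρ.Twisted c) :
    ρ.act x.1 ((ρ.act y.1 ^ (p - 1)) y.2) - ρ.act (pMap F p y.1) x.2 =
      ((fun z ↦ ⁅z, y⁆)^[p] x).2 - ρ.nestedTwist c.1.1 (letter x.1 y.1 {0}) p := by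
  have := charP_of_injective_algebraMap (algebraMap F (Module.End F (M × F))).injective p
  have h := lie_pow_char p (ρ.affine x.1 x.2) (ρ.affine y.1 y.2)
  rw [affine_pow, lie_affine, iterate_lie_eq_nestedBracket,
    ← map_letter (fun z : ρ.Twisted c ↦ ρ.affine z.1 z.2), nestedBracket_affine,
    ← iterate_lie_eq_nestedBracket, map_letter (fun z : ρ.Twisted c ↦ z.1)] at h
  have h' := congrArg Prod.fst (LinearMap.congr_fun h ((0 : M), (1 : F)))
  rwa [affine_apply_zero_one, affine_apply_zero_one] at h'

end Affine

/-- The split operator corrected by ω. In the module component, additivity is `act_pow_add` plus the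
star-property, and compatibility with the bracket is `act_pow_lie` plus β = 0. -/
instance [hp : Fact p.Prime] [CharP F p] : RestrictedLieAlgebra F p (ρ.Twisted c) where
  pMap x := ⟨pMap F p x.1, (ρ.act x.1 ^ (p - 1)) x.2 + c.1.2 x.1⟩
  pMap_smul a x := by
    ext
    · exact RestrictedLieAlgebra.pMap_smul a x.1
    · change (ρ.act (a • x.1) ^ (p - 1)) (a • x.2) + c.1.2 (a • x.1) =
        a ^ p • ((ρ.act x.1 ^ (p - 1)) x.2 + c.1.2 x.1)
      rw [c.2.1.2.map_smul, map_smul ρ.act, smul_pow, LinearMap.smul_apply, map_smul, smul_smul,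
        ← pow_succ, Nat.sub_add_cancel hp.out.one_le, smul_add]
  pMap_add x y := by
    ext
    · rw [fst_add, fst_add, fst_sum]
      refine (RestrictedLieAlgebra.pMap_add x.1 y.1).trans (congrArg _ ?_)
      refine Finset.sum_congr rfl fun S _ ↦ ?_
      rw [fst_smul, fst_nestedBracket, map_letter (fun z : ρ.Twisted c ↦ z.1)]
    · rw [snd_add]
      change (ρ.act (x.1 + y.1) ^ (p - 1)) (x.2 + y.2) + c.1.2 (x.1 + y.1) = _
      rw [act_pow_add, c.2.1.2.map_add]
      simp only [smul_sub, Finset.sum_sub_distrib, snd_add, snd_sum, snd_smul]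
      abel
  lie_pMap x y := by
    ext
    · rw [iterate_lie_eq_nestedBracket, fst_nestedBracket, map_letter (fun z : ρ.Twisted c ↦ z.1),
        ← iterate_lie_eq_nestedBracket]
      exact RestrictedLieAlgebra.lie_pMap x.1 y.1
    · have h := beta_eq_zero (c := c) x.1 y.1
      rw [beta_eq] at h
      have h' := act_pow_lie x y
      rw [snd_lie]
      change c.1.1 x.1 (pMap F p y.1) +
        ρ.act x.1 ((ρ.act y.1 ^ (p - 1)) y.2 + c.1.2 y.1) - ρ.act (pMap F p y.1) x.2 = _
      rw [map_add]
      linear_combination (norm := module) (1 : F) • h + (1 : F) • h'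

end Twisted

end RestrictedRep

universe u v w

lemma pMap_add {F : Type*} {p : ℕ} {L : Type*} [Field F] [LieRing L] [LieAlgebra F L]
    [RestrictedLieAlgebra F p L] (x y : L) : pMap F p (x + y) = pMap F p x + pMap F p y +
      ∑ S ∈ words p, (S.card : F)⁻¹ • nestedBracket (letter x y S) (p - 1) :=
  RestrictedLieAlgebra.pMap_add x y

/-! ### Extensions, sections and retractions -/

namespace RestrictedExtension

variable {F : Type u} {p : ℕ} {g : Type v} {h : Type w} [Field F]
  [LieRing g] [LieAlgebra F g] [RestrictedLieAlgebra F p g]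
  [LieRing h] [LieAlgebra F h] [RestrictedLieAlgebra F p h]

/-- The restricted extension of `g` by the strongly abelian `h` given by a restricted 2-cocycle. -/
def ofCocycle [hp : Fact p.Prime] [CharP F p] (hh : IsStronglyAbelian F p h)
    {ρ : RestrictedRep F p g h} (c : ρ.Z2) : RestrictedExtension F p g h where
  L := ρ.Twisted c
  instLieRing := inferInstance
  instLieAlgebra := inferInstance
  incl :=
    { toFun := fun m ↦ ⟨0, m⟩
      map_add' := fun _ _ ↦ RestrictedRep.Twisted.ext (by simp) rfl
      map_smul' := fun _ _ ↦ RestrictedRep.Twisted.ext (by simp) rfl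
      map_lie' := fun {m n} ↦ RestrictedRep.Twisted.ext (by simp) (by simp [hh.lie_eq_zero]) }
  proj :=
    { toFun := fun x ↦ x.1
      map_add' := fun _ _ ↦ rfl
      map_smul' := fun _ _ ↦ rfl
      map_lie' := rfl }
  IsExtension :=
    { ker_eq_bot := by
        rw [LieHom.ker_eq_bot]
        exact fun m n hmn ↦ congrArg RestrictedRep.Twisted.snd hmn
      range_eq_top := by
        rw [LieHom.range_eq_top]
        exact fun x ↦ ⟨⟨x, 0⟩, rfl⟩
      exact := by
        rw [LieHom.range_eq_ker_iff]
        exact fun x ↦ ⟨fun hx ↦ ⟨x.2, RestrictedRep.Twisted.ext hx.symm rfl⟩,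
          by rintro ⟨m, rfl⟩; rfl⟩ }
  instRestricted := inferInstance
  incl_pMap m := by
    refine RestrictedRep.Twisted.ext ?_ ?_
    · exact pMap_zero.symm
    · have h₀ : c.1.2 0 = 0 := by
        have := c.2.1.2.map_smul 0 0
        rwa [zero_smul, zero_pow hp.out.ne_zero, zero_smul] at this
      have h₁ : p - 1 ≠ 0 := by have := hp.out.two_le; omega
      change pMap F p m = (ρ.act 0 ^ (p - 1)) m + c.1.2 0
      rw [hh.pMap_eq_zero, h₀, map_zero, zero_pow h₁, LinearMap.zero_apply, add_zero]
  proj_pMap _ := rfl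

lemma ofCocycle_induces [Fact p.Prime] [CharP F p] (hh : IsStronglyAbelian F p h)
    {ρ : RestrictedRep F p g h} (c : ρ.Z2) : (ofCocycle hh c).Induces ρ := by
  intro x m
  refine RestrictedRep.Twisted.ext (lie_zero (x : ρ.Twisted c).1).symm ?_
  change ρ.act (x : ρ.Twisted c).1 m = c.1.1 (x : ρ.Twisted c).1 0 +
    ρ.act (x : ρ.Twisted c).1 m - ρ.act 0 (x : ρ.Twisted c).2
  simp

/-- The pair `(φ, ω)` measures the failure of the section `σ` to be a homomorphism of restricted Lie
algebras. -/
structure IsCocycleOf (E : RestrictedExtension F p g h) (σ : g →ₗ[F] E.L)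
    (c : (g →ₗ[F] g →ₗ[F] h) × (g → h)) : Prop where
  incl_fst : ∀ x y, E.incl (c.1 x y) = ⁅σ x, σ y⁆ - σ ⁅x, y⁆
  incl_snd : ∀ x, E.incl (c.2 x) = pMap F p (σ x) - σ (pMap F p x)

variable {E : RestrictedExtension F p g h}

lemma IsCocycleOf.unique {σ : g →ₗ[F] E.L} {c c' : (g →ₗ[F] g →ₗ[F] h) × (g → h)}
    (hc : E.IsCocycleOf σ c) (hc' : E.IsCocycleOf σ c') : c = c' := by
  refine Prod.ext ?_ ?_
  · ext x y
    exact E.incl_injective ((hc.incl_fst x y).trans (hc'.incl_fst x y).symm)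
  · funext x
    exact E.incl_injective ((hc.incl_snd x).trans (hc'.incl_snd x).symm)

variable (E) in
lemma exists_incl_eq {x : E.L} (hx : E.proj x = 0) : ∃ m, E.incl m = x :=
  ((LieHom.range_eq_ker_iff E.incl E.proj).1 E.IsExtension.exact x).1 hx

variable (E) in
lemma exists_section : ∃ σ : g →ₗ[F] E.L, ∀ x, E.proj (σ x) = x := by
  obtain ⟨σ, hσ⟩ := LinearMap.exists_rightInverse_of_surjective (E.proj : E.L →ₗ[F] g)
    (LinearMap.range_eq_top.2 E.proj_surjective)
  exact ⟨σ, LinearMap.congr_fun hσ⟩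

-- Choosing preimages under the inclusion linearly makes the cocycle of a section bilinear and the
-- induced action linear.
variable (E) in
lemma exists_retraction : ∃ r : E.L →ₗ[F] h, ∀ x, E.proj x = 0 → E.incl (r x) = x := by
  obtain ⟨r, hr⟩ := LinearMap.exists_leftInverse_of_injective (E.incl : h →ₗ[F] E.L)
    (LinearMap.ker_eq_bot.2 E.incl_injective)
  refine ⟨r, fun x hx ↦ ?_⟩
  obtain ⟨m, rfl⟩ := E.exists_incl_eq hx
  exact congrArg E.incl (LinearMap.congr_fun hr m)

lemma lie_eq_zero_of_proj (hh : IsStronglyAbelian F p h) {x y : E.L} (hx : E.proj x = 0)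
    (hy : E.proj y = 0) : ⁅x, y⁆ = 0 := by
  obtain ⟨m, rfl⟩ := E.exists_incl_eq hx
  obtain ⟨n, rfl⟩ := E.exists_incl_eq hy
  rw [← LieHom.map_lie, hh.lie_eq_zero, map_zero]

/-- Stated for a bare linear map `a`, since it also serves to prove that the induced action respects
p-operators. -/
lemma iterate_lie_incl {a : g →ₗ[F] Module.End F h}
    (ha : ∀ (x : E.L) (m : h), E.incl (a (E.proj x) m) = ⁅x, E.incl m⁆) (x : E.L) (m : h) (n : ℕ) :
    (fun z ↦ ⁅z, x⁆)^[n] (E.incl m) = (-1 : F) ^ n • E.incl ((a (E.proj x) ^ n) m) := by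
  induction n with
  | zero => simp
  | succ n ih =>
    rw [Function.iterate_succ_apply', ih, smul_lie, ← lie_skew, ← ha, pow_succ, pow_succ',
      mul_neg_one, neg_smul, smul_neg, Module.End.mul_apply]

/-! ### The cocycle of a section and its dependence on the section -/

section Induces

variable {ρ : RestrictedRep F p g h} {σ : g →ₗ[F] E.L} {c : (g →ₗ[F] g →ₗ[F] h) × (g → h)}

lemma Induces.incl_act (hE : E.Induces ρ) (hσ : ∀ x, E.proj (σ x) = x) (x : g) (m : h) :
    E.incl (ρ.act x m) = ⁅σ x, E.incl m⁆ := by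
  rw [← hE, hσ]

/-- With p letters this gives the star-property, with p + 1 letters it gives β = 0. -/
lemma IsCocycleOf.nestedBracket_section (hc : E.IsCocycleOf σ c) (hE : E.Induces ρ)
    (hσ : ∀ x, E.proj (σ x) = x) (u : ℕ → g) (n : ℕ) :
    nestedBracket (fun i ↦ σ (u i)) n =
      σ (nestedBracket u n) + E.incl (ρ.nestedTwist c.1 u n) := by
  induction n with
  | zero => simp [nestedBracket, RestrictedRep.nestedTwist]
  | succ n ih =>
    rw [nestedBracket, ih, nestedBracket, RestrictedRep.nestedTwist, map_sub, hc.incl_fst,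
      hE.incl_act hσ, add_lie, ← lie_skew _ (E.incl _)]
    abel

lemma IsCocycleOf.mem_C2 (hc : E.IsCocycleOf σ c) (hE : E.Induces ρ)
    (hσ : ∀ x, E.proj (σ x) = x) : c ∈ ρ.C2 := by
  refine ⟨fun x ↦ E.incl_injective ?_, fun a x ↦ E.incl_injective ?_,
    fun x y ↦ E.incl_injective ?_⟩
  · rw [hc.incl_fst, lie_self, lie_self, map_zero, sub_zero, map_zero]
  · have h₁ : pMap F p (σ (a • x)) = a ^ p • pMap F p (σ x) := by
      rw [map_smul]
      exact RestrictedLieAlgebra.pMap_smul a (σ x)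
    have h₂ : pMap F p (a • x) = a ^ p • pMap F p x := RestrictedLieAlgebra.pMap_smul a x
    rw [map_smul, hc.incl_snd, hc.incl_snd, h₁, h₂, map_smul, smul_sub]
  · have h₃ : ∀ S : Finset ℕ, nestedBracket (letter (σ x) (σ y) S) (p - 1) =
        σ (nestedBracket (letter x y S) (p - 1)) +
          E.incl (ρ.starTerm c.1 (letter x y S)) := fun S ↦ by
      rw [← map_letter σ, hc.nestedBracket_section hE hσ, ρ.starTerm_eq_nestedTwist]
    rw [map_add, map_add, hc.incl_snd, hc.incl_snd, hc.incl_snd, pMap_add, map_add σ,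
      pMap_add, map_add, map_add, map_sum, map_sum]
    simp only [map_smul, h₃, smul_add, Finset.sum_add_distrib]
    abel

lemma IsCocycleOf.mem_Z2 (hc : E.IsCocycleOf σ c) (hE : E.Induces ρ)
    (hσ : ∀ x, E.proj (σ x) = x) : c ∈ ρ.Z2 := by
  refine ⟨hc.mem_C2 hE hσ, LinearMap.mem_ker.2 (Prod.ext ?_ ?_)⟩
  · funext x y z
    refine E.incl_injective ?_
    change E.incl (ρ.deltaCl2 c.1 x y z) = E.incl 0
    have h₁ : σ ⁅⁅x, y⁆, z⁆ = σ ⁅x, ⁅y, z⁆⁆ - σ ⁅y, ⁅x, z⁆⁆ := by rw [lie_lie, map_sub]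
    have h₂ : σ ⁅⁅x, z⁆, y⁆ = - σ ⁅y, ⁅x, z⁆⁆ := by rw [← lie_skew, map_neg]
    have h₃ : σ ⁅⁅y, z⁆, x⁆ = - σ ⁅x, ⁅y, z⁆⁆ := by rw [← lie_skew, map_neg]
    simp only [RestrictedRep.deltaCl2, map_add, map_sub, hc.incl_fst, hE.incl_act hσ, lie_sub,
      h₁, h₂, h₃, map_zero]
    rw [← lie_skew (σ z) (σ ⁅x, y⁆), ← lie_skew (σ y) (σ ⁅x, z⁆), ← lie_skew (σ x) (σ ⁅y, z⁆),
      leibniz_lie (σ x) (σ y) (σ z), ← lie_skew (σ z) ⁅σ x, σ y⁆]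
    abel
  · funext x y
    refine E.incl_injective ?_
    change E.incl (ρ.beta c.1 c.2 x y) = E.incl 0
    have h₁ := hc.nestedBracket_section hE hσ (letter x y {0}) p
    have h₂ : ⁅σ x, pMap F p (σ y)⁆ = _ := RestrictedLieAlgebra.lie_pMap (σ x) (σ y)
    have h₃ : ⁅x, pMap F p y⁆ = _ := RestrictedLieAlgebra.lie_pMap x y
    rw [map_letter σ, ← iterate_lie_eq_nestedBracket, ← iterate_lie_eq_nestedBracket, ← h₂,
      ← h₃] at h₁
    rw [ρ.beta_eq, map_add, map_sub, hc.incl_fst, hE.incl_act hσ, hc.incl_snd, lie_sub, h₁,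
      map_zero]
    abel

lemma Induces.exists_isCocycleOf (hE : E.Induces ρ) (hσ : ∀ x, E.proj (σ x) = x) :
    ∃ c : ρ.Z2, E.IsCocycleOf σ c := by
  obtain ⟨r, hr⟩ := E.exists_retraction
  let φ : g →ₗ[F] g →ₗ[F] h :=
    LinearMap.mk₂ F (fun x y ↦ r (⁅σ x, σ y⁆ - σ ⁅x, y⁆))
      (fun _ _ _ ↦ by simp; abel) (fun _ _ _ ↦ by simp [smul_sub])
      (fun _ _ _ ↦ by simp; abel) (fun _ _ _ ↦ by simp [smul_sub])
  have hc : E.IsCocycleOf σ (φ, fun x ↦ r (pMap F p (σ x) - σ (pMap F p x))) :=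
    ⟨fun x y ↦ hr _ (by simp [hσ]), fun x ↦ hr _ (by rw [map_sub, E.proj_pMap, hσ, hσ, sub_self])⟩
  exact ⟨⟨_, hc.mem_Z2 hE hσ⟩, hc⟩

lemma proj_nestedBracket_eq_zero {u : ℕ → E.L} (h₀ : E.proj (u 0) = 0) (n : ℕ) :
    E.proj (nestedBracket u n) = 0 := by
  induction n with
  | zero => exact h₀
  | succ n ih => rw [nestedBracket, LieHom.map_lie, ih, zero_lie]

lemma nestedBracket_eq_zero_of_proj (hh : IsStronglyAbelian F p h) {u : ℕ → E.L}
    (h₀ : E.proj (u 0) = 0) {j : ℕ} (hj : 1 ≤ j) (h₁ : E.proj (u j) = 0) {n : ℕ} (hn : j ≤ n) :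
    nestedBracket u n = 0 := by
  obtain ⟨j, rfl⟩ := Nat.exists_eq_add_of_le' hj
  induction n, hn using Nat.le_induction with
  | base => exact lie_eq_zero_of_proj hh (proj_nestedBracket_eq_zero h₀ j) h₁
  | succ n _ ih => rw [nestedBracket, ih, zero_lie]

/-- A nested bracket whose first and some later letter lie in the abelian ideal vanishes, so of all
words only m, x, …, x survives in the addition formula. -/
lemma Induces.pMap_add_incl [hp : Fact p.Prime] [CharP F p] (hE : E.Induces ρ)
    (hh : IsStronglyAbelian F p h) (x : E.L) (m : h) :
    pMap F p (x + E.incl m) = pMap F p x + E.incl ((ρ.act (E.proj x) ^ (p - 1)) m) := by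
  have h₂ : pMap F p (E.incl m) = 0 := by rw [← E.incl_pMap, hh.pMap_eq_zero, map_zero]
  have hp2 := hp.out.two_le
  rw [add_comm x, pMap_add, Finset.sum_eq_single {0}]
  -- Uniform in p, including p = 2: this sign is the binomial coefficient (p - 1 choose p - 1).
  · have h₃ : (-1 : F) ^ (p - 1) = 1 := by
      rw [← cast_choose_pred_eq_neg_one_pow p (by omega), Nat.choose_self, Nat.cast_one]
    rw [← iterate_lie_eq_nestedBracket, iterate_lie_incl hE, h₃, Finset.card_singleton, Nat.cast_one,
      inv_one, one_smul, one_smul, h₂, zero_add]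
  · intro S hS hS'
    simp only [words, Finset.mem_filter, Finset.mem_powerset] at hS
    obtain ⟨j, hj, hj0⟩ : ∃ j ∈ S, j ≠ 0 := by
      by_contra! H
      exact hS' (Finset.Subset.antisymm (fun j hj ↦ Finset.mem_singleton.2 (H j hj))
        (Finset.singleton_subset_iff.2 hS.2.1))
    have := Finset.mem_range.1 (hS.1 hj)
    rw [nestedBracket_eq_zero_of_proj hh (j := j) (by simp [letter, hS.2.1]) (by omega)
      (by simp [letter, hj]) (by omega), smul_zero]
  · intro h
    refine absurd ?_ h
    simp [words]
    omega

/-- Changing the section by `ψ` changes the cocycle by the coboundary of `ψ`. -/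
lemma IsCocycleOf.add_incl [hp : Fact p.Prime] [CharP F p] (hc : E.IsCocycleOf σ c)
    (hE : E.Induces ρ) (hh : IsStronglyAbelian F p h) (hσ : ∀ x, E.proj (σ x) = x)
    (ψ : g →ₗ[F] h) :
    E.IsCocycleOf (σ + (E.incl : h →ₗ[F] E.L) ∘ₗ ψ) (c - ρ.delta1 ψ) where
  incl_fst x y := by
    change E.incl (c.1 x y - (-ρ.act x (ψ y) + ρ.act y (ψ x) + ψ ⁅x, y⁆)) =
      ⁅σ x + E.incl (ψ x), σ y + E.incl (ψ y)⁆ - (σ ⁅x, y⁆ + E.incl (ψ ⁅x, y⁆))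
    rw [map_sub, map_add, map_add, map_neg, hc.incl_fst, hE.incl_act hσ, hE.incl_act hσ, add_lie,
      lie_add, lie_add, ← LieHom.map_lie, hh.lie_eq_zero, map_zero, ← lie_skew (E.incl _)]
    abel
  incl_snd x := by
    change E.incl (c.2 x - (ψ (pMap F p x) - (ρ.act x ^ (p - 1)) (ψ x))) =
      pMap F p (σ x + E.incl (ψ x)) - (σ (pMap F p x) + E.incl (ψ (pMap F p x)))
    rw [hE.pMap_add_incl hh, hσ, map_sub, map_sub, hc.incl_snd]
    abel

end Induces

variable {ρ : RestrictedRep F p g h}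

lemma lie_incl_congr (hh : IsStronglyAbelian F p h) {x y : E.L} (hxy : E.proj x = E.proj y)
    (m : h) : ⁅x, E.incl m⁆ = ⁅y, E.incl m⁆ := by
  rw [← sub_eq_zero, ← sub_lie]
  exact lie_eq_zero_of_proj hh (by rw [map_sub, hxy, sub_self]) (E.proj_incl m)

variable (E) in
/-- Every restricted extension by a strongly abelian algebra induces a module structure. -/
lemma exists_induces [hp : Fact p.Prime] [CharP F p] (hh : IsStronglyAbelian F p h) :
    ∃ ρ : RestrictedRep F p g h, E.Induces ρ := by
  obtain ⟨σ, hσ⟩ := E.exists_section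
  obtain ⟨r, hr⟩ := E.exists_retraction
  let a : g →ₗ[F] Module.End F h :=
    LinearMap.mk₂ F (fun x m ↦ r ⁅σ x, E.incl m⁆)
      (fun _ _ _ ↦ by simp) (fun _ _ _ ↦ by simp)
      (fun _ _ _ ↦ by simp) (fun _ _ _ ↦ by simp)
  have ha : ∀ (x : E.L) (m : h), E.incl (a (E.proj x) m) = ⁅x, E.incl m⁆ := fun x m ↦
    (hr _ (by simp)).trans (lie_incl_congr hh (hσ _) m)
  refine ⟨⟨a, fun x y ↦ ?_, fun x ↦ ?_⟩, ha⟩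
  · obtain ⟨x, rfl⟩ := E.proj_surjective x
    obtain ⟨y, rfl⟩ := E.proj_surjective y
    ext m
    refine E.incl_injective ?_
    rw [← LieHom.map_lie, LinearMap.sub_apply, Module.End.mul_apply, Module.End.mul_apply, map_sub,
      ha, ha, ha, ha, ha, lie_lie]
  · obtain ⟨x, rfl⟩ := E.proj_surjective x
    ext m
    refine E.incl_injective ?_
    -- Bracketing p times on the right gives the sign (-1)^p = -1, which cancels the one from
    -- reversing the outer bracket.
    have h₁ : ⁅E.incl m, pMap F p x⁆ = _ := RestrictedLieAlgebra.lie_pMap (E.incl m) x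
    rw [← E.proj_pMap, ha, ← lie_skew, h₁, iterate_lie_incl ha, neg_one_pow_char, neg_one_smul, neg_neg]

lemma Induces.unique {ρ ρ' : RestrictedRep F p g h} (hρ : E.Induces ρ) (hρ' : E.Induces ρ') :
    ρ = ρ' := by
  ext x m
  obtain ⟨x, rfl⟩ := E.proj_surjective x
  exact E.incl_injective ((hρ x m).trans (hρ' x m).symm)

variable {σ : g →ₗ[F] E.L}

/-! ### Classification by cohomology -/

section

variable [Fact p.Prime] [CharP F p] (hh : IsStronglyAbelian F p h)

/-- The standard section of the extension given by a cocycle. -/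
def ofCocycleSection (c : ρ.Z2) : g →ₗ[F] (ofCocycle hh c).L where
  toFun x := (⟨x, 0⟩ : ρ.Twisted c)
  map_add' _ _ := RestrictedRep.Twisted.ext rfl (add_zero 0).symm
  map_smul' a _ := RestrictedRep.Twisted.ext rfl (smul_zero a).symm

lemma isCocycleOf_ofCocycleSection (c : ρ.Z2) :
    (ofCocycle hh c).IsCocycleOf (ofCocycleSection hh c) c where
  incl_fst x y := by
    rw [eq_sub_iff_add_eq]
    refine RestrictedRep.Twisted.ext (zero_add ⁅x, y⁆) ?_
    change c.1.1 x y + 0 = c.1.1 x y + ρ.act x 0 - ρ.act y 0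
    simp
  incl_snd x := by
    rw [eq_sub_iff_add_eq]
    refine RestrictedRep.Twisted.ext (zero_add (pMap F p x)) ?_
    change c.1.2 x + 0 = (ρ.act x ^ (p - 1)) 0 + c.1.2 x
    simp

/-- An extension is equivalent to the one given by the cocycle of any of its sections. -/
lemma IsCocycleOf.ofCocycle_equivalent {c : ρ.Z2} (hc : E.IsCocycleOf σ c) (hE : E.Induces ρ)
    (hσ : ∀ x, E.proj (σ x) = x) : (ofCocycle hh c).Equivalent E := by
  let f : ρ.Twisted c →ₗ⁅F⁆ E.L :=
    { toFun := fun x ↦ σ x.1 + E.incl x.2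
      map_add' := fun x y ↦ by simp; abel
      map_smul' := fun a x ↦ by simp
      map_lie' := fun {x y} ↦ by
        simp only [RestrictedRep.Twisted.fst_lie, RestrictedRep.Twisted.snd_lie, map_add, map_sub,
          hc.incl_fst, hE.incl_act hσ, add_lie, lie_add]
        rw [← LieHom.map_lie, hh.lie_eq_zero, map_zero, ← lie_skew (E.incl _)]
        abel }
  have hf : ∀ x, f x = σ x.1 + E.incl x.2 := fun _ ↦ rfl
  have hproj : ∀ x, E.proj (f x) = x.1 := fun x ↦ by
    rw [hf, map_add, hσ, E.proj_incl, add_zero]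
  have hbij : Function.Bijective f := by
    refine ⟨(injective_iff_map_eq_zero f).2 fun x hx ↦ ?_, fun y ↦ ?_⟩
    · have h₁ : x.1 = 0 := by rw [← hproj, hx, map_zero]
      rw [hf, h₁, map_zero, zero_add] at hx
      exact RestrictedRep.Twisted.ext h₁ (E.incl_injective (hx.trans (map_zero _).symm))
    · obtain ⟨m, hm⟩ := E.exists_incl_eq (x := y - σ (E.proj y)) (by rw [map_sub, hσ, sub_self])
      exact ⟨⟨E.proj y, m⟩, by rw [hf, hm]; abel⟩
  refine ⟨LieEquiv.ofBijective f hbij, fun x ↦ ?_, fun m ↦ ?_, hproj⟩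
  · change σ (pMap F p (x : ρ.Twisted c).1) + E.incl ((ρ.act (x : ρ.Twisted c).1 ^ (p - 1))
      (x : ρ.Twisted c).2 + c.1.2 (x : ρ.Twisted c).1) =
        pMap F p (σ (x : ρ.Twisted c).1 + E.incl (x : ρ.Twisted c).2)
    rw [hE.pMap_add_incl hh, hσ, map_add, hc.incl_snd]
    abel
  · change σ 0 + E.incl m = E.incl m
    rw [map_zero, zero_add]

-- No computation with δ² is needed: a coboundary is the cocycle of a modified section of the split
-- extension. The section is shifted by -ψ because `add_incl` subtracts.
include hh in
lemma _root_.RestrictedLie.RestrictedRep.B2_le_Z2 (ρ : RestrictedRep F p g h) : ρ.B2 ≤ ρ.Z2 := by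
  rintro _ ⟨ψ, rfl⟩
  have hE := ofCocycle_induces hh (0 : ρ.Z2)
  have hσ : ∀ x, (ofCocycle hh (0 : ρ.Z2)).proj (ofCocycleSection hh (0 : ρ.Z2) x) = x :=
    fun _ ↦ rfl
  have hc := (isCocycleOf_ofCocycleSection hh (0 : ρ.Z2)).add_incl hE hh hσ (-ψ)
  have := hc.mem_Z2 hE fun x ↦ by
    rw [LinearMap.add_apply, map_add, hσ]
    exact (congrArg _ (LieAlgebra.Extension.proj_incl _ _)).trans (add_zero x)
  simpa using this

include hh in
/-- Two extensions are equivalent if and only if their cocycles are cohomologous. -/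
lemma equivalent_iff_sub_mem_B2 {E₁ E₂ : RestrictedExtension F p g h} (hE₁ : E₁.Induces ρ)
    (hE₂ : E₂.Induces ρ) {σ₁ : g →ₗ[F] E₁.L} {σ₂ : g →ₗ[F] E₂.L}
    (hσ₁ : ∀ x, E₁.proj (σ₁ x) = x) (hσ₂ : ∀ x, E₂.proj (σ₂ x) = x) {c₁ c₂ : ρ.Z2}
    (hc₁ : E₁.IsCocycleOf σ₁ c₁) (hc₂ : E₂.IsCocycleOf σ₂ c₂) :
    E₁.Equivalent E₂ ↔ (c₁ - c₂ : (g →ₗ[F] g →ₗ[F] h) × (g → h)) ∈ ρ.B2 := by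
  constructor
  · rintro ⟨α, hα₁, hα₂, hα₃⟩
    obtain ⟨r, hr⟩ := E₂.exists_retraction
    let τ : g →ₗ[F] E₂.L := (α : E₁.L →ₗ[F] E₂.L) ∘ₗ σ₁
    have hτ : ∀ x, τ x = α (σ₁ x) := fun _ ↦ rfl
    have h₁ : E₂.IsCocycleOf τ c₁ :=
      ⟨fun x y ↦ by rw [← hα₂, hc₁.incl_fst, map_sub, LieEquiv.map_lie]; rfl,
        fun x ↦ by rw [← hα₂, hc₁.incl_snd, map_sub, hα₁]; rfl⟩
    -- The transported section τ and σ₂ both split the projection, so their difference takes values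
    -- in 𝔥.
    have h₂ := hc₂.add_incl hE₂ hh hσ₂ (r ∘ₗ (τ - σ₂))
    have h₃ : σ₂ + (E₂.incl : h →ₗ[F] E₂.L) ∘ₗ r ∘ₗ (τ - σ₂) = τ := by
      ext x
      have := hr (τ x - σ₂ x) (by rw [map_sub, hτ, hα₃, hσ₁, hσ₂, sub_self])
      change σ₂ x + E₂.incl (r (τ x - σ₂ x)) = τ x
      rw [this]
      abel
    rw [h₃] at h₂
    refine ⟨-(r ∘ₗ (τ - σ₂)), ?_⟩
    rw [map_neg, h₁.unique h₂]
    abel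
  · rintro ⟨ψ, hψ⟩
    have h₂ := hc₂.add_incl hE₂ hh hσ₂ (-ψ)
    rw [map_neg, hψ, sub_neg_eq_add, add_sub_cancel] at h₂
    -- After the shift both extensions have the cocycle c₁, so each is equivalent to the extension
    -- built from it.
    refine (hc₁.ofCocycle_equivalent hh hE₁ hσ₁).symm.trans
      (h₂.ofCocycle_equivalent hh hE₂ fun x ↦ ?_)
    change E₂.proj (σ₂ x + E₂.incl ((-ψ) x)) = x
    rw [map_add, hσ₂, E₂.proj_incl, add_zero]

include hh in
/-- Restricted extensions that induce a given module structure are classified by restricted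
cohomology in degree two. -/
lemma exists_classes_equiv_H2 (ρ : RestrictedRep F p g h) :
    ∃ Φ : Classes ρ ≃ ρ.H2, ∀ (E : RestrictedExtension F p g h) (hE : E.Induces ρ)
      (σ : g →ₗ[F] E.L), (∀ x, E.proj (σ x) = x) → ∀ c : ρ.Z2, E.IsCocycleOf σ c →
        Φ (Quotient.mk _ ⟨E, hE⟩) = Submodule.Quotient.mk c := by
  choose σ hσ using fun E : {E : RestrictedExtension F p g h // E.Induces ρ} ↦ E.1.exists_section
  choose c hc using fun E : {E : RestrictedExtension F p g h // E.Induces ρ} ↦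
    E.2.exists_isCocycleOf (hσ E)
  have key : ∀ (E₁ E₂ : {E : RestrictedExtension F p g h // E.Induces ρ})
      {σ₂ : g →ₗ[F] E₂.1.L} (_ : ∀ x, E₂.1.proj (σ₂ x) = x) {c₂ : ρ.Z2}
      (_ : E₂.1.IsCocycleOf σ₂ c₂), E₁.1.Equivalent E₂.1 ↔
        (Submodule.Quotient.mk (c E₁) : ρ.H2) = Submodule.Quotient.mk c₂ := by
    intro E₁ E₂ σ₂ hσ₂ c₂ hc₂
    rw [equivalent_iff_sub_mem_B2 hh E₁.2 E₂.2 (hσ E₁) hσ₂ (hc E₁) hc₂, Submodule.Quotient.eq]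
    rfl
  let Ψ : Classes ρ → ρ.H2 := Quotient.lift (fun E ↦ Submodule.Quotient.mk (c E))
    fun E₁ E₂ h ↦ (key E₁ E₂ (hσ E₂) (hc E₂)).1 h
  -- Independence of the chosen section is `key` applied to an extension and itself.
  refine ⟨Equiv.ofBijective Ψ ⟨?_, ?_⟩, fun E hE σ₂ hσ₂ c₂ hc₂ ↦
    (key ⟨E, hE⟩ ⟨E, hE⟩ hσ₂ hc₂).1 (Equivalent.refl E)⟩
  · rintro ⟨E₁⟩ ⟨E₂⟩ h
    exact Quotient.sound ((key E₁ E₂ (hσ E₂) (hc E₂)).2 h)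
  · intro q
    obtain ⟨c₂, rfl⟩ := Submodule.Quotient.mk_surjective _ q
    let E : {E : RestrictedExtension F p g h // E.Induces ρ} :=
      ⟨ofCocycle hh c₂, ofCocycle_induces hh c₂⟩
    exact ⟨Quotient.mk _ E, (key E E (σ₂ := ofCocycleSection hh c₂) (fun _ ↦ rfl)
      (isCocycleOf_ofCocycleSection hh c₂)).1 (Equivalent.refl _)⟩

end

end RestrictedExtension

end RestrictedLie

theorem mainTheorem5 {F : Type*} [Field F] (p : ℕ) [Fact p.Prime] [CharP F p]
    (g h : Type*) [LieRing g] [LieAlgebra F g] [RestrictedLie.RestrictedLieAlgebra F p g]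
    [LieRing h] [LieAlgebra F h] [RestrictedLie.RestrictedLieAlgebra F p h]
    (hh : RestrictedLie.IsStronglyAbelian F p h) :
    (∀ E : RestrictedLie.RestrictedExtension F p g h,
      ∃! ρ : RestrictedLie.RestrictedRep F p g h, E.Induces ρ) ∧
    ∀ ρ : RestrictedLie.RestrictedRep F p g h,
      ρ.B2 ≤ ρ.Z2 ∧
      ∃ Φ : RestrictedLie.RestrictedExtension.Classes ρ ≃ ρ.H2,
        ∀ (E : RestrictedLie.RestrictedExtension F p g h) (hE : E.Induces ρ)
          (σ : g →ₗ[F] E.L), (∀ x, E.proj (σ x) = x) →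
          ∃ c : ρ.Z2,
            (∀ x y, E.incl (c.1.1 x y) = ⁅σ x, σ y⁆ - σ ⁅x, y⁆) ∧
            (∀ x, E.incl (c.1.2 x) =
              RestrictedLie.pMap F p (σ x) - σ (RestrictedLie.pMap F p x)) ∧
            Φ (Quotient.mk _ ⟨E, hE⟩) = Submodule.Quotient.mk c := by
  refine ⟨fun E ↦ ?_, fun ρ ↦ ⟨ρ.B2_le_Z2 hh, ?_⟩⟩
  · obtain ⟨ρ, hρ⟩ := E.exists_induces hh
    exact ⟨ρ, hρ, fun ρ' hρ' ↦ hρ'.unique hρ⟩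
  · obtain ⟨Φ, hΦ⟩ := RestrictedLie.RestrictedExtension.exists_classes_equiv_H2 hh ρ
    refine ⟨Φ, fun E hE σ hσ ↦ ?_⟩
    obtain ⟨c, hc⟩ := hE.exists_isCocycleOf hσ
    exact ⟨c, hc.incl_fst, hc.incl_snd, hΦ E hE σ hσ c hc⟩
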